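/- Consider a network with cells $k=1,\dots,K$. Cell $k$ contains base stations (BSs) $q_k\in\mathcal Q_k$ with $M$ transmit antennas each and users $i_k\in\mathcal I_k$ with $N$ receive antennas each; all these sets are finite, and $\mathcal Q$, $\mathcal I$ denote the sets of all BSs and of all users. Let $\mathbf H_{i}^{q}\in\mathbb C^{N\times M}$ be the channel matrix from BS $q$ to user $i$, $\sigma_i>0$ the noise standard deviation at user $i$, $P_q\ge 0$ the power budget of BS $q$, and $\mu_q\ge 0$ a penalty parameter. The variables are the receive beamformers $\mathbf u=(\mathbf u_i)_{i\in\mathcal I}$, $\mathbf u_i\in\mathbb C^N$; the weights $\mathbf w=(w_i)_{i\in\mathcal I}$, $w_i>0$; the normalised transmit beamformers $\bar{\mathbf v}=(\bar{\mathbf v}_{i_k}^{q_k})$, $\bar{\mathbf v}_{i_k}^{q_k}\in\mathbb C^M$, for BSs and users of the same cell; and $\boldsymbol\alpha=(\alpha_q)_{q\in\mathcal Q}\in\mathbb R^{\mathcal Q}$. Put $\mathbf v_{i_k}^{q_k}=\alpha_{q_k}\bar{\mathbf v}_{i_k}^{q_k}$, $\mathbf H_{i}^{l}\mathbf v_{j_l}=\sum_{q_l\in\mathcal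 Q_l}\mathbf H_{i}^{q_l}\mathbf v_{j_l}^{q_l}$, and $$e_{i_k}(\mathbf u_{i_k},\mathbf v)=|1-\mathbf u_{i_k}^H\mathbf H_{i_k}^k\mathbf v_{i_k}|^2+\sum_{(l,j)\neq(k,i)}|\mathbf u_{i_k}^H\mathbf H_{i_k}^l\mathbf v_{j_l}|^2+\sigma_{i_k}^2\|\mathbf u_{i_k}\|^2 .$$ The penalised weighted mean square error problem is $$\min_{\mathbf u,\mathbf w,\bar{\mathbf v},\boldsymbol\alpha}\ F=\sum_{i\in\mathcal I}\big(w_i e_i(\mathbf u_i,\mathbf v)-\log w_i\big)+\sum_{q\in\mathcal Q}\mu_q|\alpha_q|\quad\text{s.t. } w_i>0\ \ \forall i\in\mathcal I,\quad \sum_{i_k\in\mathcal I_k}\|\bar{\mathbf v}_{i_k}^{q_k}\|^2\le P_{q_k},\ \ \alpha_{q_k}^2\le 1\ \ \forall q_k\in\mathcal Q .$$ A feasible point $z$ is called a stationary solution if $\liminf_{t\downarrow 0}\frac{F(z+t(y-z))-F(z)}{t}\ge 0$ for every feasible point $y$. The block coordinate descent (BCD) procedure starts from a feasible point and in each cycle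 updates the blocks $\mathbf u,\mathbf w,\bar{\mathbf v},\boldsymbol\alpha$ in this order, one at a time, replacing the block by any global minimiser of the problem over this block with the current values of the other three blocks fixed; $z^t$ denotes the point reached after $t$ full cycles. Theorem 3. From every feasible starting point the BCD procedure can be run indefinitely (all block minimisers exist). Every sequence $(z^t)$ it generates is bounded, every limit point of $(z^t)$ is a stationary solution of the problem, and the distance from $z^t$ to the set of stationary solutions tends to $0$ as $t\to\infty$. -/

import Mathlib

open Filter Topology

/-- The data of a downlink multi-cell heterogeneous network: `K` cells, where cell `k` contains
`numBS k` base stations and `numUsers k` users; `M` transmit antennas per base station and `N`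
receive antennas per user. -/
structure HetNet where
  /-- number of cells -/
  K : ℕ
  /-- number of base stations in each cell -/
  numBS : Fin K → ℕ
  /-- number of users in each cell -/
  numUsers : Fin K → ℕ
  /-- number of transmit antennas at each base station -/
  M : ℕ
  /-- number of receive antennas at each user -/
  N : ℕ
  /-- `channel i q` is the `N × M` channel matrix from base station `q` to user `i` -/
  channel : (Σ k, Fin (numUsers k)) → (Σ l, Fin (numBS l)) → Matrix (Fin N) (Fin M) ℂ
  /-- noise standard deviation at each user -/
  σ : (Σ k, Fin (numUsers k)) → ℝ
  /-- power budget of each base station -/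
  P : (Σ k, Fin (numBS k)) → ℝ
  /-- penalty parameter of each base station -/
  μ : (Σ k, Fin (numBS k)) → ℝ

namespace HetNet

variable (net : HetNet)

/-- All users `i_k` of the network. -/
abbrev User : Type := Σ k, Fin (net.numUsers k)

/-- All base stations `q_k` of the network. -/
abbrev BS : Type := Σ k, Fin (net.numBS k)

/-- The block `u` of receive beamformers, one vector of `ℂ^N` per user. -/
abbrev UBlock : Type := net.User → Fin net.N → ℂ

/-- The block `w` of weights, one real number per user. -/
abbrev WBlock : Type := net.User → ℝ

/-- The block `v̄` of normalised transmit beamformers: `vb k i q` is the vector of `ℂ^M` used by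
base station `q` of cell `k` for user `i` of the same cell `k`. -/
abbrev VBlock : Type :=
  (k : Fin net.K) → Fin (net.numUsers k) → Fin (net.numBS k) → Fin net.M → ℂ

/-- The block `α` of activation variables, one real number per base station. -/
abbrev ABlock : Type := net.BS → ℝ

/-- The variables `(u, w, v̄, α)` of the problem. -/
abbrev Point : Type := net.UBlock × net.WBlock × net.VBlock × net.ABlock

/-- The transmit beamformers `v = α v̄`. -/
def beamformer (vb : net.VBlock) (a : net.ABlock) : net.VBlock :=
  fun k i q m => (a ⟨k, q⟩ : ℂ) * vb k i q m

/-- The vector `H_i^l v_j ∈ ℂ^N`, where `j` is a user of cell `l`: what user `i` receives of the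
beamformers which the base stations of cell `l` use for user `j`. -/
def received (v : net.VBlock) (i j : net.User) : Fin net.N → ℂ :=
  ∑ q : Fin (net.numBS j.1), (net.channel i ⟨j.1, q⟩).mulVec (v j.1 j.2 q)

/-- The mean square error `e_i(u_i, v)` of user `i`. -/
noncomputable def mse (u : net.UBlock) (v : net.VBlock) (i : net.User) : ℝ :=
  ‖1 - star (u i) ⬝ᵥ net.received v i i‖ ^ 2
    + ∑ j ∈ Finset.univ.filter (fun j : net.User => j ≠ i),
        ‖star (u i) ⬝ᵥ net.received v i j‖ ^ 2
    + net.σ i ^ 2 * ∑ n, ‖u i n‖ ^ 2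

/-- The penalised weighted mean square error
`∑ i, (w_i e_i(u_i, v) - log w_i) + ∑ q, μ_q |α_q|`, with `v = α v̄`. -/
noncomputable def objective (z : net.Point) : ℝ :=
  match z with
  | (u, w, vb, a) =>
    ∑ i, (w i * net.mse u (net.beamformer vb a) i - Real.log (w i)) + ∑ q, net.μ q * |a q|

/-- The natural domain of the block `w`: the weights are positive, as `-log` requires. -/
def wSet : Set net.WBlock := {w | ∀ i, 0 < w i}

/-- The power constraints `‖v̄^q‖² ≤ P_q`. -/
def vSet : Set net.VBlock := {vb | ∀ k q, ∑ i, ∑ m, ‖vb k i q m‖ ^ 2 ≤ net.P ⟨k, q⟩}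

/-- The constraints `α_q² ≤ 1`. -/
def aSet : Set net.ABlock := {a | ∀ q, a q ^ 2 ≤ 1}

/-- The feasible set of the problem; it is a product over the four blocks and it is convex. -/
def feasible : Set net.Point := {z | z.2.1 ∈ net.wSet ∧ z.2.2.1 ∈ net.vSet ∧ z.2.2.2 ∈ net.aSet}

/-- `z` is a stationary solution of the problem: it is feasible, and the lower one-sided
directional derivative of the objective at `z` is nonnegative towards every feasible point. -/
def IsStationary (z : net.Point) : Prop :=
  z ∈ net.feasible ∧ ∀ y ∈ net.feasible,
    (0 : EReal) ≤ liminf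
      (fun t : ℝ => (((net.objective (z + t • (y - z)) - net.objective z) / t : ℝ) : EReal))
      (𝓝[>] (0 : ℝ))

/-- `x` is a global minimiser of `g` over the set `S`. -/
def IsMinimizer {X : Type} (S : Set X) (g : X → ℝ) (x : X) : Prop :=
  x ∈ S ∧ ∀ y ∈ S, g x ≤ g y

/-- One full cycle of block coordinate descent, from `(u, w, v̄, α)` to `(u', w', v̄', α')`: the
blocks are updated one at a time in the order `u`, `w`, `v̄`, `α`, each new block being any global
minimiser over that block with the current values of the other three blocks kept fixed. -/
def BCDCycle (z z' : net.Point) : Prop :=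
  match z, z' with
  | (_, w, vb, a), (u', w', vb', a') =>
    IsMinimizer Set.univ (fun x => net.objective (x, w, vb, a)) u' ∧
    IsMinimizer net.wSet (fun x => net.objective (u', x, vb, a)) w' ∧
    IsMinimizer net.vSet (fun x => net.objective (u', w', x, a)) vb' ∧
    IsMinimizer net.aSet (fun x => net.objective (u', w', vb', x)) a'

/-- `z 0, z 1, z 2, …` are the iterates of a block coordinate descent run, one per full cycle,
started at a feasible point. -/
def IsBCDRun (z : ℕ → net.Point) : Prop :=
  z 0 ∈ net.feasible ∧ ∀ t, net.BCDCycle (z t) (z (t + 1))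

end HetNet

namespace HetNet

variable {net : HetNet}

/-! The objective is a smooth function plus a penalty that involves `α` only, over a product of
convex sets. At a point where every block is optimal given the others, the derivative of the smooth
part splits into block contributions. Those of `u`, `w`, `v̄` are nonnegative, and that of `α` is
compensated by the penalty, so the point is stationary (`IsBlockwiseMinimizer.isStationary`).

It remains to see that limit points are blockwise optimal. Every cycle lands in one compact set of
feasible points: comparison with `u_i = 0` gives `e_i ≤ 1`, which bounds `u`, and `w_i = 1 / e_i` is
then trapped in a compact interval of positive numbers. Hence a limit point `x` comes with a limit
`x'` of the successors along a subsequence; the cycle relation passes to the limit, and monotone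
descent gives `x` and `x'` the same objective.

In such a cycle no block update decreases the objective. The minimisers over `u` and `w` are unique,
so these blocks do not move, and the old `v̄` is then optimal for the very data of `x`. Minimisers
over `v̄` need not be unique (take `α_q = 0`), so `v̄` may move and the `α`-update says nothing
about `x`. Optimality of `α` at `x` comes instead from the end of the preceding cycles, in the
limit. -/

/-- The weighted mean square error, i.e. the objective without its penalty. -/
noncomputable def weightedMSE (net : HetNet) (z : net.Point) : ℝ :=
  ∑ i, (z.2.1 i * net.mse z.1 (net.beamformer z.2.2.1 z.2.2.2) i - Real.log (z.2.1 i))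

theorem objective_eq (z : net.Point) :
    net.objective z = net.weightedMSE z + ∑ q, net.μ q * |z.2.2.2 q| := rfl

/-! ### Smoothness of the weighted mean square error -/

theorem differentiable_star_dotProduct_received (i j : net.User) :
    Differentiable ℝ (fun z : net.Point =>
      star (z.1 i) ⬝ᵥ net.received (net.beamformer z.2.2.1 z.2.2.2) i j) := by
  simp only [dotProduct, received, beamformer, Matrix.mulVec, Pi.star_apply, Finset.sum_apply,
    RCLike.star_def]
  have hconj : ∀ n, Differentiable ℝ
      (fun z : net.Point => (starRingEnd ℂ) (z.1 i n)) := fun n =>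
    Complex.conjCLE.differentiable.comp (by fun_prop)
  have hofReal : ∀ q, Differentiable ℝ (fun z : net.Point => ((z.2.2.2 q : ℝ) : ℂ)) := fun q =>
    Complex.ofRealCLM.differentiable.comp (by fun_prop)
  have hv : ∀ q m, Differentiable ℝ
      (fun z : net.Point => z.2.2.1 j.1 j.2 q m) := fun q m => by fun_prop
  refine Differentiable.fun_sum fun n _ => (hconj n).mul ?_
  refine Differentiable.fun_sum fun q _ => Differentiable.fun_sum fun m _ => ?_
  exact ((hofReal _).mul (hv q m)).const_mul _

theorem differentiable_mse (i : net.User) :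
    Differentiable ℝ (fun z : net.Point => net.mse z.1 (net.beamformer z.2.2.1 z.2.2.2) i) := by
  unfold mse
  have h := fun j => differentiable_star_dotProduct_received (net := net) i j
  refine ((((h i).const_sub 1).norm_sq ℝ).add
    (Differentiable.fun_sum fun j _ => (h j).norm_sq ℝ)).add (Differentiable.const_mul ?_ _)
  refine Differentiable.fun_sum fun n _ => Differentiable.norm_sq ℝ ?_
  fun_prop

theorem differentiableAt_weightedMSE {z : net.Point} (hz : z.2.1 ∈ net.wSet) :
    DifferentiableAt ℝ net.weightedMSE z := by
  unfold weightedMSE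
  have hw : ∀ i, DifferentiableAt ℝ (fun z : net.Point => z.2.1 i) z := fun i => by fun_prop
  exact DifferentiableAt.fun_sum fun i _ =>
    ((hw i).mul (differentiable_mse i z)).sub ((hw i).log (hz i).ne')

theorem continuousAt_objective {z : net.Point} (hz : z.2.1 ∈ net.wSet) :
    ContinuousAt net.objective z := by
  refine (differentiableAt_weightedMSE hz).continuousAt.add (Continuous.continuousAt ?_)
  fun_prop

/-! ### Convexity and compactness of the constraint sets -/

theorem convex_wSet : Convex ℝ net.wSet := by
  have : net.wSet = Set.univ.pi fun _ => Set.Ioi 0 := by ext; simp [wSet]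
  rw [this]
  exact convex_pi fun _ _ => convex_Ioi 0

theorem aSet_eq_Icc : net.aSet = Set.Icc (-1) 1 := by
  ext a
  simp [aSet, abs_le, Pi.le_def, forall_and]

theorem convex_aSet : Convex ℝ net.aSet :=
  aSet_eq_Icc ▸ convex_Icc _ _

theorem convexOn_finset_sum {ι E : Type*} [AddCommGroup E] [Module ℝ E] {S : Set E}
    (hS : Convex ℝ S) {s : Finset ι} {f : ι → E → ℝ} (hf : ∀ i ∈ s, ConvexOn ℝ S (f i)) :
    ConvexOn ℝ S (fun x => ∑ i ∈ s, f i x) := by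
  classical
  induction s using Finset.induction_on with
  | empty => simpa using convexOn_const 0 hS
  | insert i s hi ih =>
    simp only [Finset.sum_insert hi]
    exact (hf i (Finset.mem_insert_self i s)).add
      (ih fun j hj => hf j (Finset.mem_insert_of_mem hj))

theorem convex_vSet : Convex ℝ net.vSet := by
  simp only [vSet, Set.ofPred_forall]
  refine convex_iInter fun k => convex_iInter fun q => ?_
  have h : ConvexOn ℝ Set.univ
      (fun vb : net.VBlock => ∑ i, ∑ m, ‖vb k i q m‖ ^ 2) := by
    refine convexOn_finset_sum convex_univ fun i _ => convexOn_finset_sum convex_univ fun m _ => ?_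
    have := ((convexOn_univ_norm (E := ℂ)).pow (fun _ _ => norm_nonneg _) 2).comp_linearMap
      ((LinearMap.proj m ∘ₗ LinearMap.proj q ∘ₗ LinearMap.proj i ∘ₗ LinearMap.proj k :
        net.VBlock →ₗ[ℝ] ℂ))
    exact this
  simpa using h.convex_le (net.P ⟨k, q⟩)

theorem isCompact_aSet : IsCompact net.aSet :=
  aSet_eq_Icc ▸ isCompact_Icc

theorem isCompact_vSet : IsCompact net.vSet := by
  refine Metric.isCompact_of_isClosed_isBounded ?_ ?_
  · simp only [vSet, Set.ofPred_forall]
    refine isClosed_iInter fun k => isClosed_iInter fun q => isClosed_le ?_ continuous_const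
    fun_prop
  · have hb : Bornology.IsBounded (Set.univ.pi fun k => Set.univ.pi fun _ =>
        Set.univ.pi fun q => Set.univ.pi fun _ =>
          Metric.closedBall (0 : ℂ) (√(net.P ⟨k, q⟩)) : Set net.VBlock) :=
      .pi fun _ => .pi fun _ => .pi fun _ => .pi fun _ => Metric.isBounded_closedBall
    refine hb.subset fun vb hvb k _ i _ q _ m _ => ?_
    rw [mem_closedBall_zero_iff]
    refine Real.le_sqrt_of_sq_le (le_trans ?_ (hvb k q))
    calc ‖vb k i q m‖ ^ 2 ≤ ∑ m, ‖vb k i q m‖ ^ 2 :=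
          Finset.single_le_sum (f := fun m => ‖vb k i q m‖ ^ 2) (fun _ _ => sq_nonneg _)
            (Finset.mem_univ m)
      _ ≤ _ := Finset.single_le_sum (f := fun i => ∑ m, ‖vb k i q m‖ ^ 2)
            (fun _ _ => Finset.sum_nonneg fun _ _ => sq_nonneg _) (Finset.mem_univ i)

/-! ### Blockwise minimisers are stationary -/

/-- `z` is feasible and each of its blocks is optimal when the other three are kept fixed. -/
def IsBlockwiseMinimizer (net : HetNet) (z : net.Point) : Prop :=
  IsMinimizer Set.univ (fun x => net.objective (x, z.2.1, z.2.2.1, z.2.2.2)) z.1 ∧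
  IsMinimizer net.wSet (fun x => net.objective (z.1, x, z.2.2.1, z.2.2.2)) z.2.1 ∧
  IsMinimizer net.vSet (fun x => net.objective (z.1, z.2.1, x, z.2.2.2)) z.2.2.1 ∧
  IsMinimizer net.aSet (fun x => net.objective (z.1, z.2.1, z.2.2.1, x)) z.2.2.2

theorem tendsto_slope_weightedMSE {z : net.Point} (hz : z.2.1 ∈ net.wSet) (d : net.Point) :
    Tendsto (fun t : ℝ => (net.weightedMSE (z + t • d) - net.weightedMSE z) / t)
      (𝓝[>] 0) (𝓝 (fderiv ℝ net.weightedMSE z d)) := by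
  have h := ((differentiableAt_weightedMSE hz).hasFDerivAt.hasLineDerivAt d).tendsto_slope_zero_right
  simpa [div_eq_inv_mul] using h

theorem eventually_unit_interval : ∀ᶠ t : ℝ in 𝓝[>] 0, 0 < t ∧ t ≤ 1 :=
  eventually_of_mem (Ioc_mem_nhdsGT one_pos) fun _ h => h

theorem add_smul_sub_mem {E : Type*} [AddCommGroup E] [Module ℝ E] {s : Set E}
    (hs : Convex ℝ s) {x y : E} (hx : x ∈ s) (hy : y ∈ s) {t : ℝ} (ht : 0 < t ∧ t ≤ 1) :
    x + t • (y - x) ∈ s :=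
  hs.add_smul_sub_mem hx hy ⟨ht.1.le, ht.2⟩

theorem IsBlockwiseMinimizer.isStationary {z : net.Point} (hz : net.IsBlockwiseMinimizer z) :
    net.IsStationary z := by
  obtain ⟨u, w, vb, a⟩ := z
  obtain ⟨hu, hw, hv, ha⟩ := hz
  refine ⟨⟨hw.1, hv.1, ha.1⟩, ?_⟩
  rintro ⟨u', w', vb', a'⟩ ⟨hw', hv', ha'⟩
  set f := net.weightedMSE
  set D := fderiv ℝ f (u, w, vb, a)
  have slope := fun d => tendsto_slope_weightedMSE (net := net) (z := (u, w, vb, a)) hw.1 d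
  have hDu : 0 ≤ D (u' - u, 0, 0, 0) := by
    refine ge_of_tendsto (slope _) ?_
    filter_upwards [eventually_unit_interval] with t ht
    have := hu.2 (u + t • (u' - u)) (Set.mem_univ _)
    simp only [objective_eq] at this
    refine div_nonneg (sub_nonneg.2 ?_) ht.1.le
    simpa [f] using this
  have hDw : 0 ≤ D (0, w' - w, 0, 0) := by
    refine ge_of_tendsto (slope _) ?_
    filter_upwards [eventually_unit_interval] with t ht
    have := hw.2 (w + t • (w' - w)) (add_smul_sub_mem convex_wSet hw.1 hw' ht)
    simp only [objective_eq] at this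
    refine div_nonneg (sub_nonneg.2 ?_) ht.1.le
    simpa [f] using this
  have hDv : 0 ≤ D (0, 0, vb' - vb, 0) := by
    refine ge_of_tendsto (slope _) ?_
    filter_upwards [eventually_unit_interval] with t ht
    have := hv.2 (vb + t • (vb' - vb)) (add_smul_sub_mem convex_vSet hv.1 hv' ht)
    simp only [objective_eq] at this
    refine div_nonneg (sub_nonneg.2 ?_) ht.1.le
    simpa [f] using this
  set d : net.Point := (u', w', vb', a') - (u, w, vb, a)
  set da : net.Point := (0, 0, 0, a' - a)
  have hlim := (slope d).sub (slope da)
  have hpos : 0 ≤ D d - D da := by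
    rw [← map_sub]
    have : d - da = (u' - u, 0, 0, 0) + (0, w' - w, 0, 0) + (0, 0, vb' - vb, 0) := by
      simp [d, da]
    rw [this, map_add, map_add]
    positivity
  -- The directions `d` and `da` change `α` alike, hence also the penalty. Optimality of `α` bounds
  -- the penalty's increment below by minus the increment of `f` along `da`.
  have hle : ∀ᶠ t : ℝ in 𝓝[>] 0,
      (f ((u, w, vb, a) + t • d) - f (u, w, vb, a)) / t
          - (f ((u, w, vb, a) + t • da) - f (u, w, vb, a)) / t
        ≤ (net.objective ((u, w, vb, a) + t • d) - net.objective (u, w, vb, a)) / t := by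
    filter_upwards [eventually_unit_interval] with t ht
    rw [← sub_div, div_le_div_iff_of_pos_right ht.1]
    have := ha.2 (a + t • (a' - a)) (add_smul_sub_mem convex_aSet ha.1 ha' ht)
    simp only [objective_eq] at this ⊢
    simp [f, d, da] at this ⊢
    linarith
  have hlimE := (continuous_coe_real_ereal.tendsto _).comp hlim
  calc (0 : EReal) ≤ ((D d - D da : ℝ) : EReal) := by exact_mod_cast hpos
    _ = liminf _ (𝓝[>] (0 : ℝ)) := hlimE.liminf_eq.symm
    _ ≤ _ := by
      refine liminf_le_liminf ?_
      filter_upwards [hle] with t ht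
      exact EReal.coe_le_coe_iff.2 ht

/-! ### The receive beamformers: bounds, existence and uniqueness -/

theorem mse_congr {u u' : net.UBlock} {i : net.User} (h : u i = u' i) (v : net.VBlock) :
    net.mse u v i = net.mse u' v i := by
  simp only [mse, h]

theorem mse_eq_one {u : net.UBlock} {i : net.User} (h : u i = 0) (v : net.VBlock) :
    net.mse u v i = 1 := by
  simp [mse, h]

theorem noise_le_mse (u : net.UBlock) (v : net.VBlock) (i : net.User) :
    net.σ i ^ 2 * ∑ n, ‖u i n‖ ^ 2 ≤ net.mse u v i := by
  unfold mse
  have : 0 ≤ ∑ j ∈ Finset.univ.filter (fun j : net.User => j ≠ i),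
      ‖star (u i) ⬝ᵥ net.received v i j‖ ^ 2 := Finset.sum_nonneg fun _ _ => sq_nonneg _
  nlinarith [sq_nonneg ‖1 - star (u i) ⬝ᵥ net.received v i i‖]

theorem mse_pos (hσ : ∀ i, 0 < net.σ i) (u : net.UBlock) (v : net.VBlock) (i : net.User) :
    0 < net.mse u v i := by
  by_cases h : u i = 0
  · rw [mse_eq_one h]; exact one_pos
  · refine lt_of_lt_of_le ?_ (noise_le_mse u v i)
    obtain ⟨n, hn⟩ := Function.ne_iff.1 h
    refine mul_pos (pow_pos (hσ i) 2) (Finset.sum_pos' (fun _ _ => sq_nonneg _) ⟨n, by simp, ?_⟩)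
    exact pow_pos (norm_pos_iff.2 hn) 2

theorem norm_le_of_mse_le_one (hσ : ∀ i, 0 < net.σ i) {u : net.UBlock} {v : net.VBlock}
    {i : net.User} (h : net.mse u v i ≤ 1) (n : Fin net.N) : ‖u i n‖ ≤ 1 / net.σ i := by
  have h1 : ‖u i n‖ ^ 2 ≤ ∑ n, ‖u i n‖ ^ 2 :=
    Finset.single_le_sum (f := fun n => ‖u i n‖ ^ 2) (fun _ _ => sq_nonneg _) (Finset.mem_univ n)
  have h2 := (mul_le_mul_of_nonneg_left h1 (sq_nonneg (net.σ i))).trans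
    ((noise_le_mse u v i).trans h)
  rw [le_div_iff₀ (hσ i), ← abs_of_nonneg (mul_nonneg (norm_nonneg (u i n)) (hσ i).le),
    ← sq_le_one_iff_abs_le_one]
  linarith [mul_pow ‖u i n‖ (net.σ i) 2]

theorem norm_sq_midpoint_eq (x y : ℂ) :
    ‖(1 / 2 : ℂ) * (x + y)‖ ^ 2 = (‖x‖ ^ 2 + ‖y‖ ^ 2) / 2 - ‖x - y‖ ^ 2 / 4 := by
  have := parallelogram_law_with_norm ℝ x y
  rw [norm_mul, mul_pow]
  norm_num
  nlinarith

theorem norm_sq_midpoint_le (x y : ℂ) :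
    ‖(1 / 2 : ℂ) * (x + y)‖ ^ 2 ≤ (‖x‖ ^ 2 + ‖y‖ ^ 2) / 2 := by
  rw [norm_sq_midpoint_eq]
  linarith [sq_nonneg ‖x - y‖]

/-- The mean square error is strongly convex in the receive beamformer. -/
theorem mse_midpoint_le (u u' : net.UBlock) (v : net.VBlock) (i : net.User) :
    net.mse (fun i => (1 / 2 : ℂ) • (u i + u' i)) v i
      ≤ (net.mse u v i + net.mse u' v i) / 2
        - net.σ i ^ 2 * (∑ n, ‖u i n - u' i n‖ ^ 2) / 4 := by
  have hdot : ∀ h : Fin net.N → ℂ, star ((1 / 2 : ℂ) • (u i + u' i)) ⬝ᵥ h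
      = (1 / 2 : ℂ) * (star (u i) ⬝ᵥ h + star (u' i) ⬝ᵥ h) := fun h => by
    simp [star_smul, smul_dotProduct, add_dotProduct, mul_add]
  have hone : ∀ x y : ℂ, 1 - (1 / 2 : ℂ) * (x + y) = (1 / 2 : ℂ) * ((1 - x) + (1 - y)) :=
    fun x y => by ring
  have hsum : ∑ n, ‖((1 / 2 : ℂ) • (u i + u' i)) n‖ ^ 2
      = ((∑ n, ‖u i n‖ ^ 2) + ∑ n, ‖u' i n‖ ^ 2) / 2 - (∑ n, ‖u i n - u' i n‖ ^ 2) / 4 := by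
    simp only [Pi.smul_apply, Pi.add_apply, smul_eq_mul, norm_sq_midpoint_eq,
      Finset.sum_sub_distrib, ← Finset.sum_div, Finset.sum_add_distrib]
  have hcross := Finset.sum_le_sum fun j
      (_ : j ∈ Finset.univ.filter (fun j : net.User => j ≠ i)) =>
    norm_sq_midpoint_le (star (u i) ⬝ᵥ net.received v i j) (star (u' i) ⬝ᵥ net.received v i j)
  rw [← Finset.sum_div, Finset.sum_add_distrib] at hcross
  have hself := norm_sq_midpoint_le (1 - star (u i) ⬝ᵥ net.received v i i)
    (1 - star (u' i) ⬝ᵥ net.received v i i)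
  simp only [mse, hdot, hsum, hone]
  linarith

theorem objective_le_objective_of_mse_le {u u' : net.UBlock} {w : net.WBlock} {vb : net.VBlock}
    {a : net.ABlock} (hw : w ∈ net.wSet)
    (h : ∀ i, net.mse u (net.beamformer vb a) i ≤ net.mse u' (net.beamformer vb a) i) :
    net.objective (u, w, vb, a) ≤ net.objective (u', w, vb, a) := by
  simp only [objective]
  gcongr with i
  · exact (hw i).le
  · exact h i

theorem continuous_mse_left (v : net.VBlock) (i : net.User) :
    Continuous fun u : net.UBlock => net.mse u v i := by
  -- With `α = 1` the beamformer is `v` itself; the weight does not enter the error, so 0 serves.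
  have h := (differentiable_mse (net := net) i).continuous.comp
    (f := fun u : net.UBlock => ((u, 0, v, fun _ => 1) : net.Point)) (by fun_prop)
  have hv : net.beamformer v (fun _ => 1) = v := by
    funext k i q m
    simp [beamformer]
  simpa only [Function.comp_def, hv] using h

/-- The error is 1 at `u = 0`, and error at most 1 confines `u i` to a fixed ball, so the search is
over a compact set. -/
theorem exists_forall_mse_le (hσ : ∀ i, 0 < net.σ i) (v : net.VBlock) (i : net.User) :
    ∃ u : net.UBlock, ∀ u', net.mse u v i ≤ net.mse u' v i := by
  have hK : IsCompact (Set.univ.pi fun i => Set.univ.pi fun _ =>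
      Metric.closedBall (0 : ℂ) (1 / net.σ i) : Set net.UBlock) :=
    isCompact_univ_pi fun _ => isCompact_univ_pi fun _ => isCompact_closedBall _ _
  have h0 : (0 : net.UBlock) ∈ (Set.univ.pi fun i => Set.univ.pi fun _ =>
      Metric.closedBall (0 : ℂ) (1 / net.σ i) : Set net.UBlock) := by
    intro i _ n _
    simpa using (hσ i).le
  obtain ⟨u, -, hu⟩ := hK.exists_isMinOn ⟨0, h0⟩ (continuous_mse_left v i).continuousOn
  refine ⟨u, fun u' => ?_⟩
  by_cases h : net.mse u' v i ≤ 1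
  -- Only `u' i` is bounded; the other users' vectors do not affect this error and are reset to 0 to
  -- stay in the compact set.
  · let x : net.UBlock := Function.update 0 i (u' i)
    have hx : x i = u' i := Function.update_self _ _ _
    rw [← mse_congr hx]
    refine hu fun j _ n _ => ?_
    rw [mem_closedBall_zero_iff]
    obtain rfl | hj := eq_or_ne j i
    · rw [hx]
      exact norm_le_of_mse_le_one hσ h n
    · simpa [x, Function.update_of_ne hj] using (hσ j).le
  · have := hu h0
    simp only [Set.mem_ofPred_eq, mse_eq_one (u := (0 : net.UBlock)) rfl] at this
    exact this.trans (not_le.1 h).le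

theorem exists_isMinimizer_u (hσ : ∀ i, 0 < net.σ i) {w : net.WBlock} (hw : w ∈ net.wSet)
    (vb : net.VBlock) (a : net.ABlock) :
    ∃ u, IsMinimizer Set.univ (fun x => net.objective (x, w, vb, a)) u := by
  choose u hu using exists_forall_mse_le hσ (net.beamformer vb a)
  refine ⟨fun i => u i i, Set.mem_univ _, fun y _ => objective_le_objective_of_mse_le hw fun i => ?_⟩
  rw [mse_congr (u := fun i => u i i) (u' := u i) rfl]
  exact hu i y

theorem mse_le_of_isMinimizer {u : net.UBlock} {w : net.WBlock} {vb : net.VBlock}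
    {a : net.ABlock} (hw : w ∈ net.wSet)
    (hu : IsMinimizer Set.univ (fun x => net.objective (x, w, vb, a)) u) (i : net.User) :
    net.mse u (net.beamformer vb a) i ≤ 1 := by
  have h := hu.2 (Function.update u i 0) (Set.mem_univ _)
  simp only [objective, add_le_add_iff_right] at h
  have hj : ∀ j ∈ Finset.univ.erase i, w j * net.mse (Function.update u i 0)
      (net.beamformer vb a) j - Real.log (w j)
        = w j * net.mse u (net.beamformer vb a) j - Real.log (w j) := fun j hj => by
    rw [mse_congr (Function.update_of_ne (Finset.ne_of_mem_erase hj) _ _)]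
  rw [← Finset.add_sum_erase _ _ (Finset.mem_univ i), ← Finset.add_sum_erase _ _ (Finset.mem_univ i),
    Finset.sum_congr rfl hj, mse_eq_one (Function.update_self i 0 u)] at h
  exact le_of_mul_le_mul_left (by linarith) (hw i)

theorem eq_of_isMinimizer_u (hσ : ∀ i, 0 < net.σ i) {u u' : net.UBlock} {w : net.WBlock}
    {vb : net.VBlock} {a : net.ABlock} (hw : w ∈ net.wSet)
    (hu : IsMinimizer Set.univ (fun x => net.objective (x, w, vb, a)) u)
    (hu' : IsMinimizer Set.univ (fun x => net.objective (x, w, vb, a)) u') : u = u' := by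
  -- Strong convexity would make the midpoint strictly better than two distinct minimisers.
  have h := hu.2 (fun i => (1 / 2 : ℂ) • (u i + u' i)) (Set.mem_univ _)
  have h' := hu'.2 (fun i => (1 / 2 : ℂ) • (u i + u' i)) (Set.mem_univ _)
  simp only [objective, add_le_add_iff_right] at h h'
  have hmid := Finset.sum_le_sum fun i (_ : i ∈ Finset.univ) => sub_le_sub_right
    (mul_le_mul_of_nonneg_left (mse_midpoint_le u u' (net.beamformer vb a) i) (hw i).le)
    (Real.log (w i))
  have hnonneg : ∀ i ∈ Finset.univ,
      0 ≤ w i * (net.σ i ^ 2 * (∑ n, ‖u i n - u' i n‖ ^ 2) / 4) := fun i _ => by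
    have := hw i
    positivity
  have hsplit : ∑ i, (w i * ((net.mse u (net.beamformer vb a) i
        + net.mse u' (net.beamformer vb a) i) / 2
        - net.σ i ^ 2 * (∑ n, ‖u i n - u' i n‖ ^ 2) / 4) - Real.log (w i))
      = (∑ i, (w i * net.mse u (net.beamformer vb a) i - Real.log (w i))
        + ∑ i, (w i * net.mse u' (net.beamformer vb a) i - Real.log (w i))) / 2
        - ∑ i, w i * (net.σ i ^ 2 * (∑ n, ‖u i n - u' i n‖ ^ 2) / 4) := by
    rw [← Finset.sum_add_distrib, Finset.sum_div, ← Finset.sum_sub_distrib]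
    exact Finset.sum_congr rfl fun i _ => by ring
  have hzero := (Finset.sum_eq_zero_iff_of_nonneg hnonneg).1
    (le_antisymm (by linarith) (Finset.sum_nonneg hnonneg))
  funext i n
  have hi := hzero i (Finset.mem_univ i)
  have hs : ∑ n, ‖u i n - u' i n‖ ^ 2 = 0 := by
    have h1 := (hw i).ne'
    have h2 := (hσ i).ne'
    simpa [h1, h2] using hi
  have hn := (Finset.sum_eq_zero_iff_of_nonneg fun _ _ => sq_nonneg _).1 hs n (Finset.mem_univ n)
  simpa [sub_eq_zero] using hn

/-! ### The weights: the unique minimiser is the inverse error -/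

/-- This is `log s ≤ s - 1` at `s = x * e`; the lower bound is attained only at `x = 1 / e`. -/
theorem one_add_log_le {x e : ℝ} (hx : 0 < x) (he : 0 < e) :
    1 + Real.log e ≤ x * e - Real.log x := by
  have := Real.log_le_sub_one_of_pos (mul_pos hx he)
  rw [Real.log_mul hx.ne' he.ne'] at this
  linarith

theorem inv_mem_wSet (hσ : ∀ i, 0 < net.σ i) (u : net.UBlock) (v : net.VBlock) :
    (fun i => (net.mse u v i)⁻¹) ∈ net.wSet :=
  fun i => inv_pos.2 (mse_pos hσ u v i)

theorem isMinimizer_inv_mse (hσ : ∀ i, 0 < net.σ i) (u : net.UBlock) (vb : net.VBlock)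
    (a : net.ABlock) : IsMinimizer net.wSet (fun x => net.objective (u, x, vb, a))
      (fun i => (net.mse u (net.beamformer vb a) i)⁻¹) := by
  refine ⟨inv_mem_wSet hσ u _, fun y hy => ?_⟩
  simp only [objective, add_le_add_iff_right]
  refine Finset.sum_le_sum fun i _ => ?_
  have he := mse_pos hσ u (net.beamformer vb a) i
  rw [inv_mul_cancel₀ he.ne', Real.log_inv, sub_neg_eq_add]
  exact one_add_log_le (hy i) he

theorem isMinimizer_w_iff (hσ : ∀ i, 0 < net.σ i) {u : net.UBlock} {w : net.WBlock}
    {vb : net.VBlock} {a : net.ABlock} :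
    IsMinimizer net.wSet (fun x => net.objective (u, x, vb, a)) w ↔
      w = fun i => (net.mse u (net.beamformer vb a) i)⁻¹ := by
  refine ⟨fun h => ?_, fun h => h ▸ isMinimizer_inv_mse hσ u vb a⟩
  have hle := h.2 _ (inv_mem_wSet hσ u (net.beamformer vb a))
  simp only [objective, add_le_add_iff_right] at hle
  have hterm : ∀ i ∈ Finset.univ, (net.mse u (net.beamformer vb a) i)⁻¹
      * net.mse u (net.beamformer vb a) i - Real.log (net.mse u (net.beamformer vb a) i)⁻¹
        ≤ w i * net.mse u (net.beamformer vb a) i - Real.log (w i) := fun i _ => by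
    have he := mse_pos hσ u (net.beamformer vb a) i
    rw [inv_mul_cancel₀ he.ne', Real.log_inv, sub_neg_eq_add]
    exact one_add_log_le (h.1 i) he
  funext i
  have heq := (Finset.sum_eq_sum_iff_of_le hterm).1
    (le_antisymm (Finset.sum_le_sum hterm) hle) i (Finset.mem_univ i)
  have he := mse_pos hσ u (net.beamformer vb a) i
  rw [inv_mul_cancel₀ he.ne', Real.log_inv, sub_neg_eq_add] at heq
  refine eq_inv_of_mul_eq_one_left ?_
  by_contra hne
  have := Real.log_lt_sub_one_of_pos (mul_pos (h.1 i) he) hne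
  rw [Real.log_mul (h.1 i).ne' he.ne'] at this
  linarith

/-! ### Existence of block minimisers and of runs -/

theorem exists_isMinimizer_v (hP : ∀ q, 0 ≤ net.P q) (u : net.UBlock) {w : net.WBlock}
    (hw : w ∈ net.wSet) (a : net.ABlock) :
    ∃ vb, IsMinimizer net.vSet (fun x => net.objective (u, w, x, a)) vb := by
  have hc : Continuous fun x => net.objective (u, w, x, a) :=
    continuous_iff_continuousAt.2 fun x =>
      (continuousAt_objective (z := (u, w, x, a)) hw).comp
        (f := fun x => ((u, w, x, a) : net.Point)) (by fun_prop)
  obtain ⟨vb, hvb, h⟩ := isCompact_vSet.exists_isMinOn ⟨0, fun k q => by simpa using hP ⟨k, q⟩⟩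
    hc.continuousOn
  exact ⟨vb, hvb, fun y hy => h hy⟩

theorem exists_isMinimizer_a (u : net.UBlock) {w : net.WBlock} (hw : w ∈ net.wSet)
    (vb : net.VBlock) :
    ∃ a, IsMinimizer net.aSet (fun x => net.objective (u, w, vb, x)) a := by
  have hc : Continuous fun x => net.objective (u, w, vb, x) :=
    continuous_iff_continuousAt.2 fun x =>
      (continuousAt_objective (z := (u, w, vb, x)) hw).comp
        (f := fun x => ((u, w, vb, x) : net.Point)) (by fun_prop)
  obtain ⟨a, ha, h⟩ := isCompact_aSet.exists_isMinOn ⟨0, fun q => by simp⟩ hc.continuousOn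
  exact ⟨a, ha, fun y hy => h hy⟩

theorem BCDCycle.mem_feasible {z z' : net.Point} (h : net.BCDCycle z z') : z' ∈ net.feasible :=
  ⟨h.2.1.1, h.2.2.1.1, h.2.2.2.1⟩

theorem exists_bcdCycle (hσ : ∀ i, 0 < net.σ i) (hP : ∀ q, 0 ≤ net.P q) {z : net.Point}
    (hz : z ∈ net.feasible) : ∃ z', net.BCDCycle z z' := by
  obtain ⟨u, hu⟩ := exists_isMinimizer_u hσ hz.1 z.2.2.1 z.2.2.2
  have hw := isMinimizer_inv_mse hσ u z.2.2.1 z.2.2.2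
  obtain ⟨vb, hvb⟩ := exists_isMinimizer_v hP u hw.1 z.2.2.2
  obtain ⟨a, ha⟩ := exists_isMinimizer_a u hw.1 vb
  exact ⟨(u, _, vb, a), hu, hw, hvb, ha⟩

theorem exists_isBCDRun (hσ : ∀ i, 0 < net.σ i) (hP : ∀ q, 0 ≤ net.P q) {z₀ : net.Point}
    (hz₀ : z₀ ∈ net.feasible) : ∃ z : ℕ → net.Point, z 0 = z₀ ∧ net.IsBCDRun z := by
  choose next hnext using fun z : net.feasible => exists_bcdCycle hσ hP z.2
  let step : net.feasible → net.feasible := fun z => ⟨next z, (hnext z).mem_feasible⟩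
  refine ⟨fun t => (step^[t] ⟨z₀, hz₀⟩ : net.feasible), rfl, hz₀, fun t => ?_⟩
  simp only [Function.iterate_succ_apply']
  exact hnext _

/-! ### A compact set that absorbs every cycle -/

/-- Since `w > 0` is an open condition, boundedness alone would not keep limit points feasible; a
compact subset of the feasible set does. -/
theorem exists_isCompact_forall_bcdCycle_mem (hσ : ∀ i, 0 < net.σ i) :
    ∃ K ⊆ net.feasible, IsCompact K ∧
      ∀ z ∈ net.feasible, ∀ z', net.BCDCycle z z' → z' ∈ K := by
  let U : Set net.UBlock := Set.univ.pi fun i => Set.univ.pi fun _ =>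
    Metric.closedBall (0 : ℂ) (1 / net.σ i)
  have hU : IsCompact U :=
    isCompact_univ_pi fun _ => isCompact_univ_pi fun _ => isCompact_closedBall _ _
  -- A positive continuous function is bounded below on a compact set. The factor `{0}` merely fills
  -- the irrelevant weight coordinate.
  have hmse : ∀ i, ∃ c, 0 < c ∧ ∀ z ∈ U ×ˢ ({0} : Set net.WBlock) ×ˢ net.vSet ×ˢ net.aSet,
      c ≤ net.mse z.1 (net.beamformer z.2.2.1 z.2.2.2) i := fun i =>
    (hU.prod (isCompact_singleton.prod (isCompact_vSet.prod isCompact_aSet))).exists_forall_le'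
      (differentiable_mse i).continuous.continuousOn fun _ _ => mse_pos hσ _ _ _
  choose c hc hcle using hmse
  refine ⟨U ×ˢ Set.Icc 1 (fun i => (c i)⁻¹) ×ˢ net.vSet ×ˢ net.aSet, ?_,
    hU.prod (isCompact_Icc.prod (isCompact_vSet.prod isCompact_aSet)), ?_⟩
  · rintro z ⟨-, hw, hv, ha⟩
    exact ⟨fun i => one_pos.trans_le (hw.1 i), hv, ha⟩
  · rintro ⟨u, w, vb, a⟩ ⟨hw, hv, ha⟩ ⟨u', w', vb', a'⟩ ⟨hu', hw', hv', ha'⟩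
    have hle := mse_le_of_isMinimizer hw hu'
    have huU : u' ∈ U := fun i _ n _ =>
      mem_closedBall_zero_iff.2 (norm_le_of_mse_le_one hσ (hle i) n)
    obtain rfl := (isMinimizer_w_iff hσ).1 hw'
    refine ⟨huU, ⟨fun i => ?_, fun i => ?_⟩, hv'.1, ha'.1⟩
    · exact one_le_inv_iff₀.2 ⟨mse_pos hσ _ _ _, hle i⟩
    · exact inv_anti₀ (hc i) (hcle i (u', 0, vb, a) ⟨huU, rfl, hv, ha⟩)

/-! ### Block optimality and cycles in the limit -/

theorem objective_le_of_tendsto {p q : ℕ → net.Point} {x y : net.Point}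
    (hp : Tendsto p atTop (𝓝 x)) (hq : Tendsto q atTop (𝓝 y)) (hx : x.2.1 ∈ net.wSet)
    (hy : y.2.1 ∈ net.wSet) (h : ∀ j, net.objective (p j) ≤ net.objective (q j)) :
    net.objective x ≤ net.objective y :=
  le_of_tendsto_of_tendsto' ((continuousAt_objective hx).tendsto.comp hp)
    ((continuousAt_objective hy).tendsto.comp hq) h

theorem isMinimizer_a_of_tendsto {z : ℕ → net.Point} {x : net.Point} (hx : x ∈ net.feasible)
    (hz : Tendsto z atTop (𝓝 x))
    (h : ∀ j, IsMinimizer net.aSet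
      (fun a => net.objective ((z j).1, (z j).2.1, (z j).2.2.1, a)) (z j).2.2.2) :
    IsMinimizer net.aSet (fun a => net.objective (x.1, x.2.1, x.2.2.1, a)) x.2.2.2 := by
  obtain ⟨h1, h2, h3, h4⟩ : Tendsto (fun j => (z j).1) atTop (𝓝 x.1) ∧
      Tendsto (fun j => (z j).2.1) atTop (𝓝 x.2.1) ∧
      Tendsto (fun j => (z j).2.2.1) atTop (𝓝 x.2.2.1) ∧
      Tendsto (fun j => (z j).2.2.2) atTop (𝓝 x.2.2.2) :=
    ⟨hz.fst_nhds, hz.snd_nhds.fst_nhds, hz.snd_nhds.snd_nhds.fst_nhds,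
      hz.snd_nhds.snd_nhds.snd_nhds⟩
  exact ⟨hx.2.2, fun a ha => objective_le_of_tendsto hz
    (h1.prodMk_nhds (h2.prodMk_nhds (h3.prodMk_nhds tendsto_const_nhds))) hx.1 hx.1
    fun j => (h j).2 a ha⟩

/-- The relation `BCDCycle` is closed in the feasible set. -/
theorem bcdCycle_of_tendsto {z z' : ℕ → net.Point} {x x' : net.Point}
    (hx : x ∈ net.feasible) (hx' : x' ∈ net.feasible)
    (hz : Tendsto z atTop (𝓝 x)) (hz' : Tendsto z' atTop (𝓝 x'))
    (h : ∀ j, net.BCDCycle (z j) (z' j)) : net.BCDCycle x x' := by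
  have hw := hz.snd_nhds.fst_nhds
  have hv := hz.snd_nhds.snd_nhds.fst_nhds
  have ha := hz.snd_nhds.snd_nhds.snd_nhds
  have hu' := hz'.fst_nhds
  have hw' := hz'.snd_nhds.fst_nhds
  have hv' := hz'.snd_nhds.snd_nhds.fst_nhds
  refine ⟨⟨Set.mem_univ _, fun y hy => ?_⟩, ⟨hx'.1, fun y hy => ?_⟩, ⟨hx'.2.1, fun y hy => ?_⟩,
    isMinimizer_a_of_tendsto hx' hz' fun j => (h j).2.2.2⟩
  · exact objective_le_of_tendsto (hu'.prodMk_nhds (hw.prodMk_nhds (hv.prodMk_nhds ha)))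
      (tendsto_const_nhds.prodMk_nhds (hw.prodMk_nhds (hv.prodMk_nhds ha))) hx.1 hx.1
      fun j => (h j).1.2 y hy
  · exact objective_le_of_tendsto (hu'.prodMk_nhds (hw'.prodMk_nhds (hv.prodMk_nhds ha)))
      (hu'.prodMk_nhds (tendsto_const_nhds.prodMk_nhds (hv.prodMk_nhds ha))) hx'.1 hy
      fun j => (h j).2.1.2 y hy
  · exact objective_le_of_tendsto (hu'.prodMk_nhds (hw'.prodMk_nhds (hv'.prodMk_nhds ha)))
      (hu'.prodMk_nhds (hw'.prodMk_nhds (tendsto_const_nhds.prodMk_nhds ha))) hx'.1 hx'.1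
      fun j => (h j).2.2.1.2 y hy

/-! ### Descent, and limit points of a run -/

theorem BCDCycle.objective_le {z z' : net.Point} (hz : z ∈ net.feasible)
    (h : net.BCDCycle z z') : net.objective z' ≤ net.objective z :=
  (((h.2.2.2.2 _ hz.2.2).trans (h.2.2.1.2 _ hz.2.1)).trans (h.2.1.2 _ hz.1)).trans
    (h.1.2 _ (Set.mem_univ _))

/-- A cycle without decrease starts at a blockwise minimiser, provided that the last block is
optimal at its start. Only the minimisers over `u` and `w` need to be unique. -/
theorem BCDCycle.isBlockwiseMinimizer (hσ : ∀ i, 0 < net.σ i) {z z' : net.Point}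
    (hz : z ∈ net.feasible) (h : net.BCDCycle z z') (heq : net.objective z' = net.objective z)
    (ha : IsMinimizer net.aSet (fun x => net.objective (z.1, z.2.1, z.2.2.1, x)) z.2.2.2) :
    net.IsBlockwiseMinimizer z := by
  obtain ⟨u, w, vb, a⟩ := z
  obtain ⟨u', w', vb', a'⟩ := z'
  obtain ⟨hu', hw', hv', ha'⟩ := h
  -- By `heq` all four inequalities of this chain are equalities.
  have h1 : net.objective (u', w, vb, a) ≤ net.objective (u, w, vb, a) := hu'.2 u (Set.mem_univ _)
  have h2 : net.objective (u', w', vb, a) ≤ net.objective (u', w, vb, a) := hw'.2 w hz.1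
  have h3 : net.objective (u', w', vb', a) ≤ net.objective (u', w', vb, a) := hv'.2 vb hz.2.1
  have h4 : net.objective (u', w', vb', a') ≤ net.objective (u', w', vb', a) := ha'.2 a hz.2.2
  have hu : IsMinimizer Set.univ (fun x => net.objective (x, w, vb, a)) u :=
    ⟨Set.mem_univ _, fun y hy => le_trans (by linarith) (hu'.2 y hy)⟩
  obtain rfl := eq_of_isMinimizer_u hσ hz.1 hu hu'
  have hw : IsMinimizer net.wSet (fun x => net.objective (u, x, vb, a)) w :=
    ⟨hz.1, fun y hy => le_trans (by linarith) (hw'.2 y hy)⟩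
  obtain rfl : w = w' := ((isMinimizer_w_iff hσ).1 hw).trans ((isMinimizer_w_iff hσ).1 hw').symm
  exact ⟨hu, hw, ⟨hz.2.1, fun y hy => le_trans (by linarith) (hv'.2 y hy)⟩, ha⟩

theorem IsBCDRun.mem_feasible {z : ℕ → net.Point} (hz : net.IsBCDRun z) :
    ∀ t, z t ∈ net.feasible
  | 0 => hz.1
  | t + 1 => (hz.2 t).mem_feasible

theorem IsBCDRun.antitone_objective {z : ℕ → net.Point} (hz : net.IsBCDRun z) :
    Antitone fun t => net.objective (z t) :=
  antitone_nat_of_succ_le fun t => (hz.2 t).objective_le (hz.mem_feasible t)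

theorem IsBCDRun.isStationary_of_mapClusterPt (hσ : ∀ i, 0 < net.σ i) {z : ℕ → net.Point}
    (hz : net.IsBCDRun z) {x : net.Point} (hx : MapClusterPt x atTop z) :
    net.IsStationary x := by
  obtain ⟨K, hKf, hK, hmem⟩ := exists_isCompact_forall_bcdCycle_mem hσ
  have hzK : ∀ t, z (t + 1) ∈ K := fun t => hmem _ (hz.mem_feasible t) _ (hz.2 t)
  obtain ⟨ψ, hψ, hψx⟩ := hx.tendsto_subseq
  -- The shift to `j + 1` makes the index `ψ (j + 1)` positive, so the point there is itself the
  -- outcome of a cycle: it lies in `K` and its `α` is optimal.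
  obtain ⟨x', hx'K, θ, hθ, hθx'⟩ := hK.tendsto_subseq fun j => hzK (ψ (j + 1))
  have hφ : Tendsto (fun j => ψ (θ j + 1)) atTop atTop :=
    hψ.tendsto_atTop.comp ((tendsto_add_atTop_nat 1).comp hθ.tendsto_atTop)
  have hφx : Tendsto (fun j => z (ψ (θ j + 1))) atTop (𝓝 x) :=
    hψx.comp ((tendsto_add_atTop_nat 1).comp hθ.tendsto_atTop)
  have hsucc : ∀ j, ∃ s, ψ (θ j + 1) = s + 1 := fun j =>
    Nat.exists_eq_succ_of_ne_zero (Nat.ne_zero_of_lt (hψ (Nat.lt_succ_self (θ j))))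
  have hxf : x ∈ net.feasible := hKf <| hK.isClosed.mem_of_tendsto hφx <|
    Eventually.of_forall fun j => by
      obtain ⟨s, hs⟩ := hsucc j
      exact hs ▸ hzK s
  have hx'f : x' ∈ net.feasible := hKf hx'K
  -- The objective decreases along the run, so its limit along one subsequence is the limit of the
  -- whole sequence, including the successors.
  have hlim : Tendsto (fun t => net.objective (z t)) atTop (𝓝 (net.objective x)) :=
    (tendsto_iff_tendsto_subseq_of_antitone hz.antitone_objective hφ).2
      ((continuousAt_objective hxf.1).tendsto.comp hφx)
  have hlim' := hlim.comp ((tendsto_add_atTop_nat 1).comp hφ)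
  have heq : net.objective x' = net.objective x :=
    tendsto_nhds_unique ((continuousAt_objective hx'f.1).tendsto.comp hθx') hlim'
  refine (BCDCycle.isBlockwiseMinimizer hσ hxf
    (bcdCycle_of_tendsto hxf hx'f hφx hθx' fun j => hz.2 _) heq
    (isMinimizer_a_of_tendsto hxf hφx fun j => ?_)).isStationary
  obtain ⟨s, hs⟩ := hsucc j
  exact hs ▸ (hz.2 s).2.2.2

theorem IsBCDRun.isBounded_range (hσ : ∀ i, 0 < net.σ i) {z : ℕ → net.Point}
    (hz : net.IsBCDRun z) : Bornology.IsBounded (Set.range z) := by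
  obtain ⟨K, -, hK, hmem⟩ := exists_isCompact_forall_bcdCycle_mem hσ
  refine (hK.isBounded.insert (z 0)).subset ?_
  rintro _ ⟨_ | t, rfl⟩
  · exact Set.mem_insert _ _
  · exact Set.mem_insert_of_mem _ (hmem _ (hz.mem_feasible t) _ (hz.2 t))

end HetNet

/-- A bounded sequence in a proper space approaches every set that contains its cluster points. -/
theorem tendsto_infEDist_of_mapClusterPt_mem {X : Type*} [PseudoMetricSpace X] [ProperSpace X]
    {z : ℕ → X} (hz : Bornology.IsBounded (Set.range z)) {S : Set X}
    (hS : ∀ x, MapClusterPt x atTop z → x ∈ S) :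
    Tendsto (fun t => Metric.infEDist (z t) S) atTop (𝓝 0) := by
  rw [ENNReal.tendsto_nhds_zero]
  intro ε hε
  by_contra hcon
  obtain ⟨ψ, hψ, hψε⟩ := extraction_of_frequently_atTop (not_eventually.1 hcon)
  -- A subsequence staying away from `S` would still have a cluster point, which lies in `S`.
  obtain ⟨x, -, θ, hθ, hlim⟩ := tendsto_subseq_of_bounded hz (x := z ∘ ψ) fun j => ⟨ψ j, rfl⟩
  have hx : x ∈ S := hS x <|
    MapClusterPt.of_comp (hψ.tendsto_atTop.comp hθ.tendsto_atTop) hlim.mapClusterPt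
  obtain ⟨j, hj⟩ := ((EMetric.tendsto_nhds.1 hlim) ε hε).exists
  exact hψε (θ j) ((Metric.infEDist_le_edist_of_mem hx).trans hj.le)

theorem theorem3 (net : HetNet)
    (hσ : ∀ i, 0 < net.σ i) (hP : ∀ q, 0 ≤ net.P q) (hμ : ∀ q, 0 ≤ net.μ q) :
    (∀ z₀ ∈ net.feasible, ∃ z : ℕ → net.Point, z 0 = z₀ ∧ net.IsBCDRun z) ∧
    (∀ z : ℕ → net.Point, net.IsBCDRun z →
      Bornology.IsBounded (Set.range z) ∧
      (∀ x : net.Point, MapClusterPt x atTop z → net.IsStationary x) ∧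
      Tendsto (fun t => Metric.infEDist (z t) {x | net.IsStationary x}) atTop (𝓝 0)) := by
  refine ⟨fun z₀ hz₀ => HetNet.exists_isBCDRun hσ hP hz₀, fun z hz => ?_⟩
  have hb := hz.isBounded_range hσ
  have hs := fun x => hz.isStationary_of_mapClusterPt hσ (x := x)
  exact ⟨hb, hs, tendsto_infEDist_of_mapClusterPt_mem hb hs⟩
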